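/- Let $n$ be a natural number and let $\pm[n]=\{1,\dots,n,-n,\dots,-1\}$ be totally ordered by $1<2<\dots<n<-n<\dots<-2<-1$. A signed permutation is a permutation $w$ of $\pm[n]$ with $w(-a)=-w(a)$; its one-line notation is $[w(1),\dots,w(n)]$ and its unfolding is the word $w(1),\dots,w(n),w(-n),\dots,w(-1)$. Let $D_n$ be the group (under composition) of even signed permutations, i.e. those for which the number of negative entries among $w(1),\dots,w(n)$ is even, regarded as a Coxeter group with generators $s_1,\dots,s_n$: for $k<n$, $s_k$ exchanges the values $k$ and $k+1$ (and $-k$ and $-(k+1)$), and $s_n$ exchanges $n-1$ and $-n$ (and $-(n-1)$ and $n$). Let $\ell$ be the length function, and let $\star$ be the Demazure product on $D_n$: $s_k\star w=w$ if $\ell(s_kw)<\ell(w)$, $s_k\star w=s_kw$ otherwise, and $v\star w=s_{k_1}\star(s_{k_2}\star\cdots(s_{k_r}\star w))$ for any reduced expression $v=s_{k_1}\cdots s_{k_r}$. For $t\in\pm[n]$ and a list $L$ of elements of $\pm[n]$, the hopping operator $h_{t,L}$ acts on a signed permutation $w$ as follows. Among the elements of $L$ that are greater than $t$ and stand to the right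 of $t$ in the unfolding of $w$, take the one, $q$, that is furthest to the right in the list $L$; exchange $t$ with $q$, and also $-t$ with $-q$ (unless $t=-q$), in the unfolding; repeat with the resulting signed permutation until there is no such element. Let $1\le i\le n-1$, and let $Q_i\in D_n$ and the list $L_i$ be given by one of the following forms (these are the possible factors in the maximal-parabolic decomposition $Q_{n-1}\cdots Q_1$ of elements of $D_n$): * (form 0) $Q_i=\mathrm{id}$ and $L_i=[\,]$; * (form 1) $Q_i=s_i\cdots s_j$ and $L_i=[i+1,\dots,j+1]$, where $i\le j\le n-1$; * (form 2) $Q_i=s_i\cdots s_{n-2}\,s_n\,s_{n-1}\cdots s_j$ and $L_i=[i+1,\dots,n,-n,\dots,-(j+1)]$, where $i\le j\le n-1$ (for $i=n-1$: $Q_{n-1}=s_ns_{n-1}$ and $L_{n-1}=[n,-n]$); * (form 3) $Q_i=s_i\cdots s_{n-2}\,s_n$ and $L_i=[i+1,\dots,n-1,-n]$ (for $i=n-1$: $Q_{n-1}=s_n$ and $L_{n-1}=[-n]$). Then for every even signed permutation $w\in D_n$, $$Q_i\star w=h_{i,L_i}(Q_iw).$$ -/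

import Mathlib

namespace HopD

/-- The set `±[n] = {1, …, n} ∪ {-1, …, -n}`: the values, and also the positions, of the unfolding
of a signed permutation. -/
@[ext]
structure Letter (n : ℕ) where
  val : ℤ
  ne_zero : val ≠ 0
  neg_le : -(n : ℤ) ≤ val
  le : val ≤ n

namespace Letter

variable {n : ℕ}

instance : DecidableEq (Letter n) := fun _ _ => decidable_of_iff _ Letter.ext_iff.symm

theorem range (a : Letter n) : a.val ≠ 0 ∧ -(n : ℤ) ≤ a.val ∧ a.val ≤ n :=
  ⟨a.ne_zero, a.neg_le, a.le⟩

noncomputable instance : Fintype (Letter n) :=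
  Fintype.ofInjective
    (fun a => (⟨a.val, Finset.mem_Icc.2 a.range.2⟩ : {x // x ∈ Finset.Icc (-(n : ℤ)) n}))
    (fun _ _ h => Letter.ext (congrArg Subtype.val h))

instance : InvolutiveNeg (Letter n) where
  neg a := ⟨-a.val, by have := a.range; omega, by have := a.range; omega,
    by have := a.range; omega⟩
  neg_neg a := Letter.ext (neg_neg a.val)

@[simp] theorem val_neg (a : Letter n) : (-a).val = -a.val := rfl

/-- The place of a letter in the list `1, 2, …, n, -n, …, -2, -1`. -/
def rank (a : Letter n) : ℤ := if 0 < a.val then a.val else 2 * n + 1 + a.val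

theorem rank_injective : Function.Injective (rank (n := n)) := by
  intro a b h
  have ha := a.range
  have hb := b.range
  apply Letter.ext
  unfold rank at h
  split_ifs at h <;> omega

/-- The total order `1 < 2 < ⋯ < n < -n < ⋯ < -2 < -1` on `±[n]`. -/
instance : LinearOrder (Letter n) := LinearOrder.lift' rank rank_injective

theorem lt_iff (a b : Letter n) : a < b ↔ rank a < rank b := Iff.rfl

/-- The list of letters with the given integer values (every list below has its entries
in `±[n]`, so that nothing is dropped). -/
def ofInts (n : ℕ) (l : List ℤ) : List (Letter n) :=
  l.filterMap fun a => if h : a ≠ 0 ∧ -(n : ℤ) ≤ a ∧ a ≤ n then some ⟨a, h.1, h.2.1, h.2.2⟩ else none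

end Letter

/-- Signed permutations of `[n]`: permutations `w` of `±[n]` with `w (-a) = - w a`, under
composition. The one-line notation is `[w 1, …, w n]`, and the unfolding is
`[w 1, …, w n, w (-n), …, w (-1)]`, that is, `w` read along the positions in increasing order. -/
def SignedPerm (n : ℕ) : Subgroup (Equiv.Perm (Letter n)) where
  carrier := {w | ∀ a, w (-a) = -w a}
  mul_mem' := by
    intro v w hv hw a
    simp only [Set.mem_ofPred_eq] at hv hw
    rw [Equiv.Perm.mul_apply, Equiv.Perm.mul_apply, hw, hv]
  one_mem' := fun _ => rfl
  inv_mem' := by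
    intro w hw a
    simp only [Set.mem_ofPred_eq] at hw
    rw [Equiv.Perm.inv_eq_iff_eq, hw, ← Equiv.Perm.mul_apply, mul_inv_cancel, Equiv.Perm.one_apply]

namespace SignedPerm

variable {n : ℕ}

theorem apply_neg (w : SignedPerm n) (a : Letter n) : w.1 (-a) = -w.1 a := w.2 a

theorem inv_apply_neg (w : SignedPerm n) (a : Letter n) : w.1⁻¹ (-a) = -w.1⁻¹ a := (w⁻¹).2 a

/-- The product over the positions `1, …, n` of the signs of the entries of `w`. -/
noncomputable def signProd (w : SignedPerm n) : ℤˣ :=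
  ∏ a : Letter n with 0 < a.val, if (w.1 a).val < 0 then -1 else 1

theorem signProd_eq (w : SignedPerm n) : signProd w =
    (-1) ^ (Finset.univ.filter fun a : Letter n => 0 < a.val ∧ (w.1 a).val < 0).card := by
  rw [signProd, Finset.prod_ite, Finset.prod_const_one, Finset.prod_const, mul_one,
    Finset.filter_filter]

theorem even_iff (w : SignedPerm n) :
    Even (Finset.univ.filter fun a : Letter n => 0 < a.val ∧ (w.1 a).val < 0).card ↔
      signProd w = 1 := by
  rw [signProd_eq]
  rcases Nat.even_or_odd
    (Finset.univ.filter fun a : Letter n => 0 < a.val ∧ (w.1 a).val < 0).card with h | h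
  · simp [h]
  · simp [h.neg_one_pow, Nat.not_even_iff_odd.2 h]

theorem signProd_mul (v w : SignedPerm n) : signProd (v * w) = signProd v * signProd w := by
  have key : signProd v =
      ∏ a : Letter n with 0 < a.val,
        if (0 < (w.1 a).val ↔ (v.1 (w.1 a)).val < 0) then (-1 : ℤˣ) else 1 := by
    symm
    unfold signProd
    refine Finset.prod_bij (fun a _ => if 0 < (w.1 a).val then w.1 a else -w.1 a) ?_ ?_ ?_ ?_
    · intro a ha
      have := (w.1 a).2
      simp only [Finset.mem_filter, Finset.mem_univ, true_and]
      split_ifs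
      · assumption
      · rw [Letter.val_neg]; omega
    · intro a ha b hb h
      simp only [Finset.mem_filter, Finset.mem_univ, true_and] at ha hb
      split_ifs at h
      · exact w.1.injective h
      · rw [← apply_neg] at h
        have := congrArg Letter.val (w.1.injective h)
        rw [Letter.val_neg] at this; omega
      · rw [← apply_neg] at h
        have := congrArg Letter.val (w.1.injective h)
        rw [Letter.val_neg] at this; omega
      · exact w.1.injective (neg_injective h)
    · intro b hb
      simp only [Finset.mem_filter, Finset.mem_univ, true_and] at hb
      have h0 := (w.1⁻¹ b).range
      by_cases h : 0 < (w.1⁻¹ b).val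
      · refine ⟨w.1⁻¹ b, by simpa using h, ?_⟩
        simp [hb]
      · refine ⟨-w.1⁻¹ b, ?_, ?_⟩
        · simp only [Finset.mem_filter, Finset.mem_univ, true_and, Letter.val_neg]; omega
        · rw [apply_neg, ← Equiv.Perm.mul_apply, mul_inv_cancel, Equiv.Perm.one_apply,
            if_neg, neg_neg]
          rw [Letter.val_neg]; omega
    · intro a ha
      have h0 := (w.1 a).range
      have h1 := (v.1 (w.1 a)).range
      by_cases h : 0 < (w.1 a).val
      · simp [h]
      · simp only [h, false_iff, if_false, apply_neg, Letter.val_neg]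
        congr 1
        apply propext; omega
  rw [key, signProd, signProd, ← Finset.prod_mul_distrib]
  refine Finset.prod_congr rfl ?_
  intro a _
  have h0 := (w.1 a).range
  by_cases h : 0 < (w.1 a).val
  · have : ¬ (w.1 a).val < 0 := by omega
    by_cases h2 : (v.1 (w.1 a)).val < 0 <;> simp [h, this, h2]
  · have : (w.1 a).val < 0 := by omega
    by_cases h2 : (v.1 (w.1 a)).val < 0 <;> simp [h, this, h2]

theorem signProd_one : signProd (1 : SignedPerm n) = 1 := by
  refine Finset.prod_eq_one ?_
  intro a ha
  simp only [Finset.mem_filter, Finset.mem_univ, true_and] at ha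
  rw [if_neg]
  change ¬ a.val < 0
  omega

/-- The signed permutation that exchanges the values `a` and `b`, and also `-a` and `-b`
(unless `a = -b`, when it only exchanges `a` and `b`). -/
def signedSwap (a b : Letter n) : SignedPerm n :=
  ⟨if a = -b then Equiv.swap a b else Equiv.swap a b * Equiv.swap (-a) (-b), by
    intro x
    have ha := a.range
    have hb := b.range
    have hx := x.range
    have e : ∀ y z : Letter n, y = z ↔ y.val = z.val := fun y z => Letter.ext_iff
    split_ifs with h
    · subst h
      simp only [Equiv.swap_apply_def, e, Letter.val_neg] at *
      split_ifs <;> (try simp only [Letter.val_neg] at *) <;> omega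
    · simp only [Equiv.Perm.mul_apply, Equiv.swap_apply_def]
      simp only [e, Letter.val_neg] at *
      split_ifs <;> (try simp only [Letter.val_neg] at *) <;> omega⟩

theorem signedSwap_apply (a b x : Letter n) : (signedSwap a b).1 x =
    if x = a then b else if x = b then a else if x = -a then -b else if x = -b then -a else x := by
  have ha := a.range
  have hb := b.range
  have hx := x.range
  have e : ∀ y z : Letter n, y = z ↔ y.val = z.val := fun y z => Letter.ext_iff
  unfold signedSwap
  simp only
  split_ifs with h <;>
    simp only [Equiv.Perm.mul_apply, Equiv.swap_apply_def] <;>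
    simp only [e, Letter.val_neg] at * <;>
    split_ifs <;> (try simp only [Letter.val_neg] at *) <;> omega

theorem signedSwap_left (a b : Letter n) : (signedSwap a b).1 a = b := by
  rw [signedSwap_apply, if_pos rfl]

theorem signedSwap_right (a b : Letter n) : (signedSwap a b).1 b = a := by
  rw [signedSwap_apply, if_pos rfl]
  split_ifs with h
  · exact h
  · rfl

theorem signedSwap_mul_self (a b : Letter n) : signedSwap a b * signedSwap a b = 1 := by
  apply Subtype.ext
  ext1 x
  change (signedSwap a b).1 ((signedSwap a b).1 x) = x
  by_cases h1 : x = a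
  · rw [h1, signedSwap_left, signedSwap_right]
  by_cases h2 : x = b
  · rw [h2, signedSwap_right, signedSwap_left]
  by_cases h3 : x = -a
  · rw [h3, apply_neg, signedSwap_left, apply_neg, signedSwap_right]
  by_cases h4 : x = -b
  · rw [h4, apply_neg, signedSwap_right, apply_neg, signedSwap_left]
  have h : (signedSwap a b).1 x = x := by
    rw [signedSwap_apply, if_neg h1, if_neg h2, if_neg h3, if_neg h4]
  rw [h, h]

/-- The hopping operator `h_{t,L}`. Among the letters of `L` that are greater than `t` and stand to
the right of `t` in the unfolding of `w` (the position of the value `x` is `w⁻¹ x`), take the one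
furthest to the right in the list `L`, exchange `t` with it, and repeat until there is none. -/
def hop (t : Letter n) (L : List (Letter n)) (w : SignedPerm n) : SignedPerm n :=
  match h : (L.filter fun q => w.1⁻¹ t < w.1⁻¹ q ∧ t < q).getLast? with
  | none => w
  | some q => hop t L (signedSwap t q * w)
termination_by (2 * n + 1 - (w.1⁻¹ t).rank).toNat
decreasing_by
  have hq := List.mem_of_getLast? h
  simp only [List.mem_filter, decide_eq_true_eq] at hq
  have h1 : (signedSwap t q * w).1⁻¹ t = w.1⁻¹ q := by
    rw [Equiv.Perm.inv_eq_iff_eq]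
    change t = (signedSwap t q).1 (w.1 (w.1⁻¹ q))
    rw [← Equiv.Perm.mul_apply w.1, mul_inv_cancel, Equiv.Perm.one_apply, signedSwap_right]
  rw [h1]
  have h2 := (Letter.lt_iff _ _).1 hq.2.1
  have h3 := (w.1⁻¹ q).range
  have h4 : (w.1⁻¹ q).rank < 2 * n + 1 := by
    unfold Letter.rank
    split_ifs <;> omega
  omega

end SignedPerm

open SignedPerm

/-- The Coxeter group `D_n`: the even signed permutations, that is, those with an even number
of negative entries among `w 1, …, w n`. -/
def DGroup (n : ℕ) : Subgroup (SignedPerm n) where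
  carrier := {w | Even (Finset.univ.filter fun a : Letter n => 0 < a.val ∧ (w.1 a).val < 0).card}
  mul_mem' := by
    intro v w hv hw
    simp only [Set.mem_ofPred_eq, even_iff] at hv hw ⊢
    rw [signProd_mul, hv, hw, mul_one]
  one_mem' := by
    simp only [Set.mem_ofPred_eq, even_iff]
    exact signProd_one
  inv_mem' := by
    intro w hw
    simp only [Set.mem_ofPred_eq, even_iff] at hw ⊢
    have h := signProd_mul w w⁻¹
    rwa [mul_inv_cancel, signProd_one, hw, one_mul, eq_comm] at h

variable {n : ℕ}

theorem signedSwap_mem {a b : Letter n} (ha : 0 < a.val)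
    (hab' : a.val ≠ -b.val) : signedSwap a b ∈ DGroup n := by
  have e : ∀ y z : Letter n, y = z ↔ y.val = z.val := fun y z => Letter.ext_iff
  change Even (Finset.card _)
  by_cases hb : 0 < b.val
  · rw [Finset.filter_eq_empty_iff.2]
    · simp
    · intro x _
      have hx := x.range
      rw [signedSwap_apply]
      split_ifs <;> simp only [e, Letter.val_neg] at * <;> omega
  · have h : (Finset.univ.filter fun x : Letter n => 0 < x.val ∧ ((signedSwap a b).1 x).val < 0)
        = {a, -b} := by
      ext x
      have hx := x.range
      have hb' := b.range
      simp only [Finset.mem_filter, Finset.mem_univ, true_and, Finset.mem_insert,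
        Finset.mem_singleton]
      rw [signedSwap_apply]
      split_ifs <;> simp only [e, Letter.val_neg] at * <;> omega
    rw [h, Finset.card_pair]
    · exact even_two
    · simp only [ne_eq, e, Letter.val_neg]; omega

/-- The letter `k`, for `1 ≤ k ≤ n`. -/
def Letter.pos (k : ℕ) (h : 1 ≤ k ∧ k ≤ n) : Letter n :=
  ⟨k, by omega, by omega, by omega⟩

/-- The generators `s_1, …, s_n` of `D_n`: for `k < n`, `s_k` exchanges `k` and `k + 1`;
`s_n` exchanges `n - 1` and `-n` (hence `n` and `-(n - 1)`). Other indices are not used. -/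
def s (n k : ℕ) : DGroup n :=
  if h : 1 ≤ k ∧ k < n then
    ⟨signedSwap (Letter.pos k (by omega)) (Letter.pos (k + 1) (by omega)),
      signedSwap_mem (by simp only [Letter.pos]; omega) (by simp only [Letter.pos]; omega)⟩
  else if h : 2 ≤ n ∧ k = n then
    ⟨signedSwap (Letter.pos (n - 1) (by omega)) (-Letter.pos n (by omega)),
      signedSwap_mem (by simp only [Letter.pos]; omega)
        (by simp only [Letter.pos, Letter.val_neg]; omega)⟩
  else 1

/-- The product `s_{k_1} ⋯ s_{k_r}` in `D_n`, for the word `[k_1, …, k_r]`. -/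
def wordProd (n : ℕ) (ω : List ℕ) : DGroup n := (ω.map (s n)).prod

/-- `ω` is an expression for `v` in the generators `s_1, …, s_n`. -/
def IsWord (ω : List ℕ) (v : DGroup n) : Prop :=
  (∀ k ∈ ω, 1 ≤ k ∧ k ≤ n) ∧ wordProd n ω = v

/-- The length of `v`: the least number of generators in an expression for `v`. -/
noncomputable def length (v : DGroup n) : ℕ := sInf {r | ∃ ω, IsWord ω v ∧ ω.length = r}

/-- `ω` is a reduced expression for `v`. -/
def IsReducedWord (ω : List ℕ) (v : DGroup n) : Prop := IsWord ω v ∧ ω.length = length v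

theorem Letter.rank_neg (x : Letter n) : (-x).rank = 2 * n + 1 - x.rank := by
  have hx := x.range
  simp only [Letter.rank, Letter.val_neg]
  split_ifs <;> omega

theorem Letter.neg_lt_neg {x y : Letter n} (h : x < y) : -y < -x := by
  rw [Letter.lt_iff] at *
  rw [Letter.rank_neg, Letter.rank_neg]
  omega

/-- The exchange of `a` and `b` reverses the order of no pair of letters except `(a, b)` and
`(-b, -a)` and pairs of opposite letters. -/
def IsSimple (a b : Letter n) : Prop :=
  a < b ∧ b ≠ -a ∧ ∀ x y : Letter n, x < y → y ≠ -x →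
    (signedSwap a b).1 x < (signedSwap a b).1 y ∨ (x = a ∧ y = b) ∨ (x = -b ∧ y = -a)

theorem isSimple_pos {k : ℕ} (h1 : 1 ≤ k) (h2 : k < n) :
    IsSimple (Letter.pos k ⟨h1, h2.le⟩ : Letter n) (Letter.pos (k + 1) ⟨by omega, h2⟩) := by
  refine ⟨?_, ?_, ?_⟩
  · simp only [Letter.lt_iff, Letter.rank, Letter.pos]
    split_ifs <;> omega
  · simp only [ne_eq, Letter.ext_iff, Letter.val_neg, Letter.pos]
    omega
  · intro x y hxy hne
    have hx := x.range
    have hy := y.range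
    simp only [signedSwap_apply]
    simp only [Letter.lt_iff, ne_eq, Letter.ext_iff, Letter.val_neg, Letter.pos] at *
    split_ifs <;> simp only [Letter.rank, Letter.val_neg] at * <;> split_ifs at * <;> omega

theorem isSimple_last (hn : 2 ≤ n) :
    IsSimple (Letter.pos (n - 1) (by omega) : Letter n) (-Letter.pos n (by omega)) := by
  refine ⟨?_, ?_, ?_⟩
  · simp only [Letter.lt_iff, Letter.rank, Letter.pos, Letter.val_neg]
    split_ifs <;> omega
  · simp only [ne_eq, Letter.ext_iff, Letter.val_neg, Letter.pos]
    omega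
  · intro x y hxy hne
    have hx := x.range
    have hy := y.range
    simp only [signedSwap_apply]
    simp only [Letter.lt_iff, ne_eq, Letter.ext_iff, Letter.val_neg, Letter.pos] at *
    split_ifs <;> simp only [Letter.rank, Letter.val_neg] at * <;> split_ifs at * <;> omega

theorem s_eq {k : ℕ} (h1 : 1 ≤ k) (h2 : k < n) : (s n k).1 =
    signedSwap (Letter.pos k ⟨h1, h2.le⟩) (Letter.pos (k + 1) ⟨by omega, h2⟩) := by
  unfold s
  rw [dif_pos ⟨h1, h2⟩]

theorem s_last (hn : 2 ≤ n) : (s n n).1 =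
    signedSwap (Letter.pos (n - 1) (by omega)) (-Letter.pos n (by omega)) := by
  unfold s
  rw [dif_neg (by omega), dif_pos ⟨hn, rfl⟩]

theorem s_spec {k : ℕ} (hn : 2 ≤ n) (hk : 1 ≤ k ∧ k ≤ n) :
    ∃ a b : Letter n, IsSimple a b ∧ (s n k).1 = signedSwap a b := by
  rcases hk.2.lt_or_eq with h | rfl
  · exact ⟨_, _, isSimple_pos hk.1 h, s_eq hk.1 h⟩
  · exact ⟨_, _, isSimple_last hn, s_last hn⟩

/-- The inversions of the unfolding of `w`, without those at opposite positions. -/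
noncomputable def inversions (w : SignedPerm n) : Finset (Letter n × Letter n) :=
  Finset.univ.filter fun p => p.1 < p.2 ∧ p.2 ≠ -p.1 ∧ w.1 p.2 < w.1 p.1

theorem card_inversions_inv (w : SignedPerm n) :
    (inversions w⁻¹).card = (inversions w).card := by
  have hc : ∀ (v : SignedPerm n) (x : Letter n), (v⁻¹).1 (v.1 x) = x := fun v x =>
    Equiv.symm_apply_apply v.1 x
  have hd : ∀ (v : SignedPerm n) (x : Letter n), v.1 ((v⁻¹).1 x) = x := fun v x =>
    Equiv.apply_symm_apply v.1 x
  refine Finset.card_bij' (fun p _ => ((w⁻¹).1 p.2, (w⁻¹).1 p.1))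
    (fun p _ => (w.1 p.2, w.1 p.1)) ?_ ?_ ?_ ?_
  · intro p hp
    simp only [inversions, Finset.mem_filter, Finset.mem_univ, true_and] at hp ⊢
    refine ⟨hp.2.2, ?_, ?_⟩
    · rw [← apply_neg]
      intro h
      have := (w⁻¹).1.injective h
      exact hp.2.1 (by rw [this, neg_neg])
    · rw [hd, hd]; exact hp.1
  · intro p hp
    simp only [inversions, Finset.mem_filter, Finset.mem_univ, true_and] at hp ⊢
    refine ⟨hp.2.2, ?_, ?_⟩
    · rw [← apply_neg]
      intro h
      have := w.1.injective h
      exact hp.2.1 (by rw [this, neg_neg])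
    · rw [hc, hc]; exact hp.1
  · intro p _
    simp only [hd]
  · intro p _
    simp only [hc]

theorem card_inversions_mul {a b : Letter n} (hs : IsSimple a b) (w : SignedPerm n)
    (h : (w⁻¹).1 a < (w⁻¹).1 b) :
    (inversions (signedSwap a b * w)).card = (inversions w).card + 2 := by
  obtain ⟨hab, hne, hspec⟩ := hs
  have hd : ∀ x : Letter n, w.1 ((w⁻¹).1 x) = x := Equiv.apply_symm_apply w.1
  have hc : ∀ x : Letter n, (w⁻¹).1 (w.1 x) = x := Equiv.symm_apply_apply w.1
  have hi : ∀ x y : Letter n, w.1 x = y → x = (w⁻¹).1 y := fun x y e => by rw [← e, hc]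
  have hm : ∀ x, (signedSwap a b * w).1 x = (signedSwap a b).1 (w.1 x) := fun _ => rfl
  have hopp : (w⁻¹).1 b ≠ -(w⁻¹).1 a := by
    rw [← apply_neg]
    exact fun e => hne ((w⁻¹).1.injective e)
  have hset : inversions (signedSwap a b * w) =
      insert ((w⁻¹).1 a, (w⁻¹).1 b) (insert ((w⁻¹).1 (-b), (w⁻¹).1 (-a)) (inversions w)) := by
    ext ⟨x, y⟩
    simp only [inversions, Finset.mem_insert, Finset.mem_filter, Finset.mem_univ, true_and,
      Prod.mk.injEq, hm]
    constructor
    · rintro ⟨h1, h2, h3⟩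
      by_cases h4 : w.1 y < w.1 x
      · exact Or.inr (Or.inr ⟨h1, h2, h4⟩)
      · have h5 : w.1 x < w.1 y :=
          lt_of_le_of_ne (not_lt.1 h4) fun e => h1.ne (w.1.injective e)
        have h6 : w.1 y ≠ -w.1 x := by
          rw [← apply_neg]
          exact fun e => h2 (w.1.injective e)
        rcases hspec _ _ h5 h6 with h7 | h7 | h7
        · exact absurd h3 h7.not_gt
        · exact Or.inl ⟨hi _ _ h7.1, hi _ _ h7.2⟩
        · exact Or.inr (Or.inl ⟨hi _ _ h7.1, hi _ _ h7.2⟩)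
    · rintro (⟨rfl, rfl⟩ | ⟨rfl, rfl⟩ | ⟨h1, h2, h3⟩)
      · refine ⟨h, hopp, ?_⟩
        rw [hd, hd, signedSwap_left, signedSwap_right]
        exact hab
      · rw [apply_neg, apply_neg]
        refine ⟨Letter.neg_lt_neg h, ?_, ?_⟩
        · rw [neg_neg]
          exact fun e => hopp e.symm
        · rw [apply_neg w, apply_neg w, hd, hd, apply_neg, apply_neg, signedSwap_left,
            signedSwap_right]
          exact Letter.neg_lt_neg hab
      · refine ⟨h1, h2, ?_⟩
        have h6 : w.1 x ≠ -w.1 y := by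
          rw [← apply_neg]
          intro e
          exact h2 (by rw [w.1.injective e, neg_neg])
        rcases hspec _ _ h3 h6 with h7 | h7 | h7
        · exact h7
        · rw [hi _ _ h7.1, hi _ _ h7.2] at h1
          exact absurd h1 h.not_gt
        · rw [hi _ _ h7.1, hi _ _ h7.2, apply_neg, apply_neg] at h1
          exact absurd (Letter.neg_lt_neg h) h1.not_gt
  rw [hset, Finset.card_insert_of_notMem, Finset.card_insert_of_notMem]
  · simp only [inversions, Finset.mem_filter, hd, not_and]
    intro _ _ _
    exact (Letter.neg_lt_neg hab).not_gt
  · simp only [inversions, Finset.mem_insert, Finset.mem_filter, Prod.mk.injEq, hd, not_or,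
      not_and]
    refine ⟨fun e => absurd ((w⁻¹).1.injective e) ?_, fun _ _ _ => hab.not_gt⟩
    intro e
    exact hne (by rw [e, neg_neg])

theorem card_inversions_mul' {a b : Letter n} (hs : IsSimple a b) (w : SignedPerm n)
    (h : (w⁻¹).1 b < (w⁻¹).1 a) :
    (inversions w).card = (inversions (signedSwap a b * w)).card + 2 := by
  have hinv : (signedSwap a b)⁻¹ = signedSwap a b :=
    inv_eq_of_mul_eq_one_right (signedSwap_mul_self a b)
  have h1 : ∀ x, ((signedSwap a b * w)⁻¹).1 x = (w⁻¹).1 ((signedSwap a b).1 x) := by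
    intro x
    rw [mul_inv_rev, hinv]
    rfl
  have h2 := card_inversions_mul hs (signedSwap a b * w)
    (by rw [h1, h1, signedSwap_left, signedSwap_right]; exact h)
  rwa [← mul_assoc, signedSwap_mul_self, one_mul] at h2

/-- An even signed permutation without descents is the identity. -/
theorem eq_one_of_no_descent (v : DGroup n)
    (h : ∀ k (h1 : 1 ≤ k) (h2 : k < n),
      v.1.1 (Letter.pos k ⟨h1, h2.le⟩) < v.1.1 (Letter.pos (k + 1) ⟨by omega, h2⟩))
    (h' : ∀ hn : 2 ≤ n,
      v.1.1 (Letter.pos (n - 1) (by omega)) < v.1.1 (-Letter.pos n (by omega))) : v = 1 := by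
  have hodd : ∀ (hn : 1 ≤ n), (∀ k (hk : 1 ≤ k ∧ k ≤ n), k < n → 0 < (v.1.1 (Letter.pos k hk)).val) →
      0 < (v.1.1 (Letter.pos n ⟨hn, le_rfl⟩)).val := by
    intro hn hp
    by_contra hneg
    have h0 := (v.1.1 (Letter.pos n ⟨hn, le_rfl⟩)).range
    have hev : Even (Finset.univ.filter
      fun a : Letter n => 0 < a.val ∧ (v.1.1 a).val < 0).card := v.2
    have : (Finset.univ.filter fun a : Letter n => 0 < a.val ∧ (v.1.1 a).val < 0) =
        {Letter.pos n ⟨hn, le_rfl⟩} := by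
      ext x
      have hx := x.range
      simp only [Finset.mem_filter, Finset.mem_univ, true_and, Finset.mem_singleton]
      constructor
      · rintro ⟨h1, h2⟩
        have hxe : x = Letter.pos x.val.toNat (by omega) := by
          simp only [Letter.ext_iff, Letter.pos]; omega
        by_contra hne
        have h3 : x.val.toNat < n := by
          simp only [Letter.ext_iff, Letter.pos] at hne
          omega
        have := hp x.val.toNat (by omega) h3
        rw [← hxe] at this
        omega
      · rintro rfl
        refine ⟨?_, by omega⟩
        simp only [Letter.pos]; omega
    rw [this, Finset.card_singleton] at hev
    exact absurd hev (by decide)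
  have hlast : ∀ (hn : 1 ≤ n), 0 < (v.1.1 (Letter.pos n ⟨hn, le_rfl⟩)).val ∧
      ∀ hn2 : 2 ≤ n, 0 < (v.1.1 (Letter.pos (n - 1) (by omega))).val := by
    intro hn
    have hq : ∀ hn2 : 2 ≤ n, 0 < (v.1.1 (Letter.pos (n - 1) (by omega))).val := by
      intro hn2
      have e1 := h (n - 1) (by omega) (by omega)
      have e2 := h' hn2
      have e3 : (Letter.pos (n - 1 + 1) ⟨by omega, by omega⟩ : Letter n) =
          Letter.pos n ⟨hn, le_rfl⟩ := by
        simp only [Letter.ext_iff, Letter.pos]; omega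
      rw [e3] at e1
      rw [apply_neg] at e2
      have r1 := (v.1.1 (Letter.pos n ⟨hn, le_rfl⟩)).range
      have r2 := (v.1.1 (Letter.pos (n - 1) (by omega))).range
      rw [Letter.lt_iff] at e1 e2
      simp only [Letter.rank, Letter.val_neg] at e1 e2
      split_ifs at e1 e2 <;> omega
    refine ⟨hodd hn ?_, hq⟩
    intro k hk hkn
    obtain ⟨m, hm⟩ : ∃ m, k + m = n - 1 := ⟨n - 1 - k, by omega⟩
    induction m generalizing k with
    | zero =>
      have := hq (by omega)
      have e : k = n - 1 := by omega
      subst e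
      exact this
    | succ m ih =>
      have i1 := ih (k + 1) ⟨by omega, by omega⟩ (by omega) (by omega)
      have i2 := h k hk.1 hkn
      have r1 := (v.1.1 (Letter.pos (k + 1) ⟨by omega, hkn⟩)).range
      have r2 := (v.1.1 (Letter.pos k hk)).range
      rw [Letter.lt_iff] at i2
      simp only [Letter.rank] at i2
      split_ifs at i2 <;> omega
  have hup : ∀ k (hk : 1 ≤ k ∧ k ≤ n), 0 < (v.1.1 (Letter.pos k hk)).val ∧
      (v.1.1 (Letter.pos k hk)).val ≤ k := by
    intro k hk
    obtain ⟨m, hm⟩ : ∃ m, k + m = n := ⟨n - k, by omega⟩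
    induction m generalizing k with
    | zero =>
      have e : k = n := by omega
      subst e
      exact ⟨(hlast hk.1).1, (v.1.1 (Letter.pos k hk)).le⟩
    | succ m ih =>
      have i1 := ih (k + 1) ⟨by omega, by omega⟩ (by omega)
      have i2 := h k hk.1 (by omega)
      have r2 := (v.1.1 (Letter.pos k hk)).range
      rw [Letter.lt_iff] at i2
      simp only [Letter.rank] at i2
      split_ifs at i2 <;> omega
  have hdown : ∀ k (hk : 1 ≤ k ∧ k ≤ n), (k : ℤ) ≤ (v.1.1 (Letter.pos k hk)).val := by
    intro k
    induction k with
    | zero => intro hk; omega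
    | succ k ih =>
      intro hk
      have i0 := hup (k + 1) hk
      by_cases hk0 : k = 0
      · omega
      · have i1 := ih ⟨by omega, by omega⟩
        have i2 := h k (by omega) (by omega)
        have i3 := hup k ⟨by omega, by omega⟩
        rw [Letter.lt_iff] at i2
        simp only [Letter.rank] at i2
        split_ifs at i2 <;> omega
  have hfix : ∀ x : Letter n, 0 < x.val → v.1.1 x = x := by
    intro x hx
    have r := x.range
    have hxe : x = Letter.pos x.val.toNat (by omega) := by
      simp only [Letter.ext_iff, Letter.pos]; omega
    have h1 := hup x.val.toNat (by omega)
    have h2 := hdown x.val.toNat (by omega)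
    rw [← hxe] at h1 h2
    rw [Letter.ext_iff]
    omega
  apply Subtype.ext
  apply Subtype.ext
  ext1 x
  change v.1.1 x = x
  by_cases hx : 0 < x.val
  · exact hfix x hx
  · have r := x.range
    have := hfix (-x) (by rw [Letter.val_neg]; omega)
    rwa [apply_neg, neg_inj] at this

theorem s_mul_self (k : ℕ) : s n k * s n k = 1 := by
  unfold s
  split_ifs
  · exact Subtype.ext (signedSwap_mul_self _ _)
  · exact Subtype.ext (signedSwap_mul_self _ _)
  · exact one_mul 1

theorem s_mul_s_mul (k : ℕ) (v : DGroup n) : s n k * (s n k * v) = v := by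
  rw [← mul_assoc, s_mul_self, one_mul]

theorem exists_descent (hn : 2 ≤ n) (v : DGroup n) (hv : v ≠ 1) :
    ∃ k, 1 ≤ k ∧ k ≤ n ∧
      (inversions v.1).card = (inversions (s n k * v : DGroup n).1).card + 2 := by
  by_contra hcon
  push Not at hcon
  have key : ∀ k (_ : 1 ≤ k) (_ : k ≤ n) (a b : Letter n), IsSimple a b →
      (s n k).1 = signedSwap a b → (v⁻¹).1.1 a < (v⁻¹).1.1 b := by
    intro k h1 h2 a b hab e
    by_contra h
    have h3 : (v.1⁻¹).1 b < (v.1⁻¹).1 a :=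
      lt_of_le_of_ne (not_lt.1 h) fun e => hab.1.ne ((v.1⁻¹).1.injective e).symm
    refine hcon k h1 h2 ?_
    rw [card_inversions_mul' hab v.1 h3, ← e]
    rfl
  refine hv (inv_eq_one.1 (eq_one_of_no_descent v⁻¹ ?_ ?_))
  · intro k h1 h2
    exact key k h1 h2.le _ _ (isSimple_pos h1 h2) (s_eq h1 h2)
  · intro hn
    exact key n (by omega) le_rfl _ _ (isSimple_last hn) (s_last hn)

theorem eq_one_of_lt_two (hn : n < 2) (v : DGroup n) : v = 1 :=
  eq_one_of_no_descent v (fun _ _ _ => by omega) (fun _ => by omega)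

theorem inversions_one : (inversions (1 : SignedPerm n)).card = 0 := by
  rw [Finset.card_eq_zero, inversions, Finset.filter_eq_empty_iff]
  rintro p _ ⟨h1, _, h3⟩
  exact h1.not_gt h3

theorem exists_word (v : DGroup n) : ∃ ω, IsWord ω v ∧ 2 * ω.length = (inversions v.1).card := by
  generalize hN : (inversions v.1).card = N
  induction N using Nat.strong_induction_on generalizing v with
  | _ N ih =>
    by_cases hv : v = 1
    · subst hv
      refine ⟨[], ⟨by simp, rfl⟩, ?_⟩
      rw [← hN]
      exact inversions_one.symm
    · have hn : 2 ≤ n := by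
        by_contra hn
        exact hv (eq_one_of_lt_two (by omega) v)
      obtain ⟨k, h1, h2, h3⟩ := exists_descent hn v hv
      obtain ⟨ω, h4, h5⟩ := ih _ (by omega) (s n k * v) rfl
      refine ⟨k :: ω, ⟨?_, ?_⟩, ?_⟩
      · simp only [List.mem_cons, forall_eq_or_imp]
        exact ⟨⟨h1, h2⟩, h4.1⟩
      · have h6 := h4.2
        unfold wordProd at h6 ⊢
        rw [List.map_cons, List.prod_cons, h6, s_mul_s_mul]
      · rw [List.length_cons]; omega

theorem inversions_s_mul (hn : 2 ≤ n) {k : ℕ} (hk : 1 ≤ k ∧ k ≤ n) (v : DGroup n) :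
    (inversions (s n k * v : DGroup n).1).card = (inversions v.1).card + 2 ∨
    (inversions v.1).card = (inversions (s n k * v : DGroup n).1).card + 2 := by
  obtain ⟨a, b, hab, e⟩ := s_spec hn hk
  have e' : (s n k * v : DGroup n).1 = signedSwap a b * v.1 := by rw [← e]; rfl
  rw [e']
  rcases lt_or_gt_of_ne (fun e => hab.1.ne ((v.1⁻¹).1.injective e) :
    (v.1⁻¹).1 a ≠ (v.1⁻¹).1 b) with h | h
  · exact Or.inl (card_inversions_mul hab v.1 h)
  · exact Or.inr (card_inversions_mul' hab v.1 h)

theorem inversions_le_of_isWord {ω : List ℕ} {v : DGroup n} (h : IsWord ω v) :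
    (inversions v.1).card ≤ 2 * ω.length := by
  by_cases hn : 2 ≤ n
  · obtain ⟨h1, rfl⟩ := h
    induction ω with
    | nil => exact inversions_one.le
    | cons k ω ih =>
      simp only [List.mem_cons, forall_eq_or_imp] at h1
      have h2 := ih h1.2
      have h3 := inversions_s_mul hn h1.1 (wordProd n ω)
      have h4 : wordProd n (k :: ω) = s n k * wordProd n ω := by
        unfold wordProd
        rw [List.map_cons, List.prod_cons]
      rw [h4, List.length_cons]
      omega
  · rw [eq_one_of_lt_two (by omega) v]
    exact inversions_one.le.trans (Nat.zero_le _)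

/-- The length is half the number of inversions that are not at opposite positions. -/
theorem two_mul_length (v : DGroup n) : 2 * length v = (inversions v.1).card := by
  obtain ⟨ω, h1, h2⟩ := exists_word v
  have hmem : length v ∈ {r | ∃ ω, IsWord ω v ∧ ω.length = r} := Nat.sInf_mem ⟨_, ω, h1, rfl⟩
  have hle : length v ≤ ω.length := Nat.sInf_le ⟨ω, h1, rfl⟩
  obtain ⟨τ, h3, h4⟩ := hmem
  have h5 := inversions_le_of_isWord h3
  omega

theorem exists_isReducedWord (v : DGroup n) : ∃ ω, IsReducedWord ω v := by
  obtain ⟨ω, h1, h2⟩ := exists_word v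
  exact ⟨ω, h1, by have := two_mul_length v; omega⟩

/-- The Demazure product `s_k ⋆ w` of a generator and an element: the longer of `w` and `s_k w`. -/
noncomputable def simpleStar (k : ℕ) (w : DGroup n) : DGroup n :=
  if length (s n k * w) < length w then w else s n k * w

/-- The Demazure product `v ⋆ w = s_{k_1} ⋆ (s_{k_2} ⋆ ⋯ (s_{k_r} ⋆ w))`, where `s_{k_1} ⋯ s_{k_r}`
is a reduced expression for `v`; by `star_eq` any such expression gives the same element. -/
noncomputable def star (v w : DGroup n) : DGroup n :=
  (exists_isReducedWord v).choose.foldr simpleStar w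

/-- The right-handed version of `simpleStar`. -/
noncomputable def starSimple (w : DGroup n) (k : ℕ) : DGroup n :=
  if length (w * s n k) < length w then w else w * s n k

theorem length_inv (v : DGroup n) : length v⁻¹ = length v := by
  have h1 := two_mul_length v
  have h2 := two_mul_length v⁻¹
  have h3 : (inversions (v⁻¹ : DGroup n).1).card = (inversions v.1).card :=
    card_inversions_inv v.1
  omega

theorem length_one : length (1 : DGroup n) = 0 := by
  have h1 := two_mul_length (1 : DGroup n)
  have h2 : (inversions (1 : DGroup n).1).card = 0 := inversions_one
  omega

theorem length_s_mul (hn : 2 ≤ n) {k : ℕ} (hk : 1 ≤ k ∧ k ≤ n) (v : DGroup n) :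
    length (s n k * v) = length v + 1 ∨ length v = length (s n k * v) + 1 := by
  have h1 := two_mul_length v
  have h2 := two_mul_length (s n k * v)
  have h3 := inversions_s_mul hn hk v
  omega

theorem length_s_mul_lt {k : ℕ} {a b : Letter n} (hab : IsSimple a b)
    (e : (s n k).1 = signedSwap a b) (v : DGroup n) :
    length (s n k * v) < length v ↔ (v.1⁻¹).1 b < (v.1⁻¹).1 a := by
  have h1 := two_mul_length v
  have h2 := two_mul_length (s n k * v)
  have e' : (s n k * v : DGroup n).1 = signedSwap a b * v.1 := by rw [← e]; rfl
  rw [e'] at h2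
  constructor
  · intro h
    by_contra h3
    have h4 := card_inversions_mul hab v.1
      (lt_of_le_of_ne (not_lt.1 h3) fun e => hab.1.ne ((v.1⁻¹).1.injective e))
    omega
  · intro h
    have h4 := card_inversions_mul' hab v.1 h
    omega

theorem conj_signedSwap (w : SignedPerm n) (a b : Letter n) :
    signedSwap (w.1 a) (w.1 b) * w = w * signedSwap a b := by
  apply Subtype.ext
  ext1 x
  change (signedSwap (w.1 a) (w.1 b)).1 (w.1 x) = w.1 ((signedSwap a b).1 x)
  simp only [signedSwap_apply, ← apply_neg, w.1.injective.eq_iff]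
  split_ifs <;> rfl

theorem signedSwap_neg (a b : Letter n) : signedSwap (-b) (-a) = signedSwap a b := by
  apply Subtype.ext
  ext1 x
  have ha := a.range
  have hb := b.range
  have hx := x.range
  simp only [signedSwap_apply, neg_neg]
  split_ifs <;> simp only [Letter.ext_iff, Letter.val_neg] at * <;> omega

theorem signedSwap_comm (a b : Letter n) : signedSwap b a = signedSwap a b := by
  apply Subtype.ext
  ext1 x
  have ha := a.range
  have hb := b.range
  have hx := x.range
  simp only [signedSwap_apply]
  split_ifs <;> simp only [Letter.ext_iff, Letter.val_neg] at * <;> omega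

/-- The exchange property: multiplying by `s_m` on the right does not affect whether `s_k` is a
left descent, unless `s_k w = w s_m`. -/
theorem exchange (hn : 2 ≤ n) {k m : ℕ} (hk : 1 ≤ k ∧ k ≤ n) (hm : 1 ≤ m ∧ m ≤ n)
    (w : DGroup n) : s n k * w = w * s n m ∨
      (length (s n k * (w * s n m)) < length (w * s n m) ↔ length (s n k * w) < length w) := by
  obtain ⟨a, b, hab, e⟩ := s_spec hn hk
  obtain ⟨c, d, hcd, f⟩ := s_spec hn hm
  rw [length_s_mul_lt hab e, length_s_mul_lt hab e]
  have hv : ∀ x, ((w * s n m : DGroup n).1⁻¹).1 x = (signedSwap c d).1 ((w.1⁻¹).1 x) := by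
    intro x
    have : (w * s n m : DGroup n).1⁻¹ = signedSwap c d * w.1⁻¹ := by
      change (w.1 * (s n m).1)⁻¹ = _
      rw [f, mul_inv_rev, inv_eq_of_mul_eq_one_right (signedSwap_mul_self c d)]
    rw [this]
    rfl
  rw [hv, hv]
  have hd : ∀ x : Letter n, w.1.1 ((w.1⁻¹).1 x) = x := Equiv.apply_symm_apply w.1.1
  have hsw : ∀ x y, signedSwap ((w.1⁻¹).1 x) ((w.1⁻¹).1 y) = signedSwap c d →
      signedSwap x y = signedSwap a b → s n k * w = w * s n m := by
    intro x y h1 h2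
    apply Subtype.ext
    change (s n k).1 * w.1 = w.1 * (s n m).1
    rw [e, f, ← h1, ← conj_signedSwap, hd, hd, h2]
  have hopp : ∀ x y : Letter n, y ≠ -x → (w.1⁻¹).1 y ≠ -(w.1⁻¹).1 x := by
    intro x y h1 h2
    rw [← apply_neg] at h2
    exact h1 ((w.1⁻¹).1.injective h2)
  have hne : a ≠ -b := fun h => hab.2.1 (by rw [h, neg_neg])
  rcases lt_or_gt_of_ne (fun e => hab.1.ne ((w.1⁻¹).1.injective e) :
    (w.1⁻¹).1 a ≠ (w.1⁻¹).1 b) with h | h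
  · rcases hcd.2.2 _ _ h (hopp _ _ hab.2.1) with h3 | ⟨h3, h4⟩ | ⟨h3, h4⟩
    · exact Or.inr ⟨fun h4 => absurd h3 h4.not_gt, fun h4 => absurd h h4.not_gt⟩
    · exact Or.inl (hsw a b (by rw [h3, h4]) rfl)
    · exact Or.inl (hsw a b (by rw [h3, h4, signedSwap_neg]) rfl)
  · rcases hcd.2.2 _ _ h (hopp _ _ hne) with h3 | ⟨h3, h4⟩ | ⟨h3, h4⟩
    · exact Or.inr ⟨fun _ => h, fun _ => h3⟩
    · exact Or.inl (hsw b a (by rw [h3, h4]) (signedSwap_comm a b))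
    · exact Or.inl (hsw b a (by rw [h3, h4, signedSwap_neg]) (signedSwap_comm a b))

theorem s_inv (k : ℕ) : (s n k)⁻¹ = s n k := inv_eq_of_mul_eq_one_right (s_mul_self k)

theorem exchange' (hn : 2 ≤ n) {k m : ℕ} (hk : 1 ≤ k ∧ k ≤ n) (hm : 1 ≤ m ∧ m ≤ n)
    (w : DGroup n) : s n k * w = w * s n m ∨
      (length (s n k * w * s n m) < length (s n k * w) ↔ length (w * s n m) < length w) := by
  rcases exchange hn hm hk w⁻¹ with h | h
  · left
    have := congrArg (·⁻¹) h
    simp only [mul_inv_rev, s_inv, inv_inv] at this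
    exact this.symm
  · right
    have h1 : s n m * (w⁻¹ * s n k) = (s n k * w * s n m)⁻¹ := by
      simp only [mul_inv_rev, s_inv]
    have h2 : w⁻¹ * s n k = (s n k * w)⁻¹ := by simp only [mul_inv_rev, s_inv]
    have h3 : s n m * w⁻¹ = (w * s n m)⁻¹ := by simp only [mul_inv_rev, s_inv]
    rwa [h1, h2, h3, length_inv, length_inv, length_inv, length_inv] at h

theorem simpleStar_starSimple {k m : ℕ} (hk : 1 ≤ k ∧ k ≤ n) (hm : 1 ≤ m ∧ m ≤ n)
    (w : DGroup n) : simpleStar k (starSimple w m) = starSimple (simpleStar k w) m := by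
  by_cases hn : 2 ≤ n
  swap
  · rw [eq_one_of_lt_two (by omega) (simpleStar k (starSimple w m)),
      eq_one_of_lt_two (by omega) (starSimple (simpleStar k w) m)]
  by_cases heq : s n k * w = w * s n m
  · have h1 : s n k * (s n k * w) = w := s_mul_s_mul k w
    have h2 : w * s n m * s n m = w := by rw [mul_assoc, s_mul_self, mul_one]
    have h3 := length_s_mul hn hk w
    unfold simpleStar starSimple
    rw [heq] at h1 h3 ⊢
    by_cases h : length (w * s n m) < length w
    · simp only [if_pos h, heq]
    · have h' : length w < length (w * s n m) := by omega
      simp only [if_neg h, h1, h2, if_pos h']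
  · have h1 := (exchange hn hk hm w).resolve_left heq
    have h2 := (exchange' hn hk hm w).resolve_left heq
    rw [mul_assoc] at h2
    unfold simpleStar starSimple
    by_cases hl : length (s n k * w) < length w <;> by_cases hr : length (w * s n m) < length w <;>
      simp only [hl, hr, if_true, if_false, iff_true, iff_false] at h1 h2 ⊢ <;>
      simp [hl, hr, h1, h2, mul_assoc]

theorem isReducedWord_cons {k : ℕ} {ω : List ℕ} {v : DGroup n} (h : IsReducedWord (k :: ω) v) :
    2 ≤ n ∧ (1 ≤ k ∧ k ≤ n) ∧ IsReducedWord ω (s n k * v) ∧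
      length v = length (s n k * v) + 1 := by
  obtain ⟨⟨h1, h2⟩, h3⟩ := h
  rw [List.length_cons] at h3
  have hn : 2 ≤ n := by
    by_contra hn
    rw [eq_one_of_lt_two (by omega) v, length_one] at h3
    omega
  simp only [List.mem_cons, forall_eq_or_imp] at h1
  have h4 : IsWord ω (s n k * v) := by
    refine ⟨h1.2, ?_⟩
    rw [← h2]
    unfold wordProd
    rw [List.map_cons, List.prod_cons, s_mul_s_mul]
  have h5 : length (s n k * v) ≤ ω.length := Nat.sInf_le ⟨ω, h4, rfl⟩
  have h6 := length_s_mul hn h1.1 v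
  exact ⟨hn, h1.1, ⟨h4, by omega⟩, by omega⟩

theorem foldr_simpleStar_one {ω : List ℕ} {v : DGroup n} (h : IsReducedWord ω v) :
    ω.foldr simpleStar (1 : DGroup n) = v := by
  induction ω generalizing v with
  | nil => exact h.1.2
  | cons k ω ih =>
    obtain ⟨hn, hk, h1, h2⟩ := isReducedWord_cons h
    rw [List.foldr_cons, ih h1, simpleStar, s_mul_s_mul, if_neg (by omega)]

theorem isReducedWord_reverse {ω : List ℕ} {v : DGroup n} (h : IsReducedWord ω v) :
    IsReducedWord ω.reverse v⁻¹ := by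
  refine ⟨⟨fun k hk => h.1.1 k (List.mem_reverse.1 hk), ?_⟩, ?_⟩
  · rw [← h.1.2]
    unfold wordProd
    rw [List.prod_inv_reverse, List.map_reverse, List.map_map]
    congr 2
    refine List.map_congr_left fun k _ => ?_
    exact (s_inv k).symm
  · rw [List.length_reverse, length_inv, h.2]

theorem starSimple_eq_inv (w : DGroup n) (k : ℕ) : starSimple w k = (simpleStar k w⁻¹)⁻¹ := by
  have h : s n k * w⁻¹ = (w * s n k)⁻¹ := by rw [mul_inv_rev, s_inv]
  unfold starSimple simpleStar
  rw [h, length_inv, length_inv]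
  split_ifs <;> rw [inv_inv]

theorem foldl_starSimple_eq (w : DGroup n) (τ : List ℕ) :
    τ.foldl starSimple w = (τ.reverse.foldr simpleStar w⁻¹)⁻¹ := by
  induction τ generalizing w with
  | nil => exact (inv_inv w).symm
  | cons k τ ih =>
    rw [List.foldl_cons, ih, List.reverse_cons, List.foldr_append, starSimple_eq_inv, inv_inv]
    rfl

theorem foldl_starSimple_one {τ : List ℕ} {w : DGroup n} (h : IsReducedWord τ w) :
    τ.foldl starSimple (1 : DGroup n) = w := by
  rw [foldl_starSimple_eq, inv_one, foldr_simpleStar_one (isReducedWord_reverse h), inv_inv]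

theorem simpleStar_foldl {k : ℕ} (hk : 1 ≤ k ∧ k ≤ n) {τ : List ℕ} (hτ : ∀ m ∈ τ, 1 ≤ m ∧ m ≤ n)
    (w : DGroup n) : simpleStar k (τ.foldl starSimple w) = τ.foldl starSimple (simpleStar k w) := by
  induction τ generalizing w with
  | nil => rfl
  | cons m τ ih =>
    simp only [List.mem_cons, forall_eq_or_imp] at hτ
    rw [List.foldl_cons, ih hτ.2, simpleStar_starSimple hk hτ.1, List.foldl_cons]

theorem foldr_simpleStar_eq {ω τ : List ℕ} {v w : DGroup n} (h : IsReducedWord ω v)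
    (hτ : IsReducedWord τ w) : ω.foldr simpleStar w = τ.foldl starSimple v := by
  have key : ∀ ω : List ℕ, (∀ k ∈ ω, 1 ≤ k ∧ k ≤ n) →
      ω.foldr simpleStar (τ.foldl starSimple (1 : DGroup n)) =
        τ.foldl starSimple (ω.foldr simpleStar 1) := by
    intro ω hω
    induction ω with
    | nil => rfl
    | cons k ω ih =>
      simp only [List.mem_cons, forall_eq_or_imp] at hω
      rw [List.foldr_cons, ih hω.2, simpleStar_foldl hω.1 hτ.1.1, List.foldr_cons]
  have := key ω h.1.1
  rwa [foldl_starSimple_one hτ, foldr_simpleStar_one h] at this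

/-- The Demazure product does not depend on the reduced expression. -/
theorem star_eq {ω : List ℕ} {v : DGroup n} (h : IsReducedWord ω v) (w : DGroup n) :
    star v w = ω.foldr simpleStar w := by
  obtain ⟨τ, hτ⟩ := exists_isReducedWord w
  rw [foldr_simpleStar_eq h hτ]
  exact foldr_simpleStar_eq (exists_isReducedWord v).choose_spec hτ

theorem star_one (v : DGroup n) : star v 1 = v :=
  foldr_simpleStar_one (exists_isReducedWord v).choose_spec

theorem one_star (w : DGroup n) : star 1 w = w := by
  have h : IsReducedWord [] (1 : DGroup n) := ⟨⟨by simp, rfl⟩, length_one.symm⟩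
  rw [star_eq h]
  rfl

theorem simpleStar_simpleStar (hn : 2 ≤ n) {k : ℕ} (hk : 1 ≤ k ∧ k ≤ n) (w : DGroup n) :
    simpleStar k (simpleStar k w) = simpleStar k w := by
  have h0 := length_s_mul hn hk w
  by_cases h : length (s n k * w) < length w
  · simp only [simpleStar, if_pos h]
  · have h1 : length w < length (s n k * w) := by omega
    simp only [simpleStar, if_neg h, s_mul_s_mul, if_pos h1]

theorem isReducedWord_cons_mul {k : ℕ} (hk : 1 ≤ k ∧ k ≤ n) {ω : List ℕ} {v : DGroup n}
    (h : IsReducedWord ω v) (hl : length (s n k * v) = length v + 1) :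
    IsReducedWord (k :: ω) (s n k * v) := by
  refine ⟨⟨?_, ?_⟩, ?_⟩
  · simp only [List.mem_cons, forall_eq_or_imp]
    exact ⟨hk, h.1.1⟩
  · rw [← h.1.2]
    unfold wordProd
    rw [List.map_cons, List.prod_cons]
  · rw [List.length_cons, h.2, hl]

theorem star_simpleStar (hn : 2 ≤ n) {k : ℕ} (hk : 1 ≤ k ∧ k ≤ n) (v w : DGroup n) :
    star (simpleStar k v) w = simpleStar k (star v w) := by
  rcases length_s_mul hn hk v with h | h
  · obtain ⟨ω, hω⟩ := exists_isReducedWord v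
    rw [simpleStar, if_neg (by omega), star_eq (isReducedWord_cons_mul hk hω h), star_eq hω]
    rfl
  · obtain ⟨ω, hω⟩ := exists_isReducedWord (s n k * v)
    have h1 := isReducedWord_cons_mul hk hω (by rw [s_mul_s_mul]; exact h)
    rw [s_mul_s_mul] at h1
    rw [simpleStar, if_pos (by omega), star_eq h1, List.foldr_cons, simpleStar_simpleStar hn hk]

/-- The Demazure product makes `D_n` a monoid, with the same identity as the group. -/
theorem star_assoc (u v w : DGroup n) : star (star u v) w = star u (star v w) := by
  by_cases hn : 2 ≤ n
  · obtain ⟨ω, hω⟩ := exists_isReducedWord u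
    rw [star_eq hω, star_eq hω]
    have h := hω.1.1
    clear hω
    induction ω with
    | nil => rfl
    | cons k ω ih =>
      simp only [List.mem_cons, forall_eq_or_imp] at h
      rw [List.foldr_cons, star_simpleStar hn h.1, ih h.2, List.foldr_cons]
  · rw [eq_one_of_lt_two (by omega) (star (star u v) w),
      eq_one_of_lt_two (by omega) (star u (star v w))]

/-- `s_k ⋆ w` is the longer of `w` and `s_k w`. -/
theorem s_star (hn : 2 ≤ n) {k : ℕ} (hk : 1 ≤ k ∧ k ≤ n) (w : DGroup n) :
    star (s n k) w = simpleStar k w := by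
  have h0 := length_s_mul hn hk (1 : DGroup n)
  rw [length_one] at h0
  have h : simpleStar k (1 : DGroup n) = s n k := by
    rw [simpleStar, length_one, if_neg (by omega), mul_one]
  rw [← h, star_simpleStar hn hk, one_star]

theorem s_star_self (hn : 2 ≤ n) {k : ℕ} (hk : 1 ≤ k ∧ k ≤ n) :
    star (s n k) (s n k) = s n k := by
  have h0 := length_s_mul hn hk (1 : DGroup n)
  rw [length_one, mul_one] at h0
  rw [s_star hn hk, simpleStar, s_mul_self, length_one, if_pos (by omega)]

/-- A reduced product is also the Demazure product of the same generators. -/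
theorem star_eq_mul {u v : DGroup n} (h : length (u * v) = length u + length v) :
    star u v = u * v := by
  obtain ⟨ω, hω⟩ := exists_isReducedWord u
  obtain ⟨τ, hτ⟩ := exists_isReducedWord v
  have h1 : IsReducedWord (ω ++ τ) (u * v) := by
    refine ⟨⟨?_, ?_⟩, ?_⟩
    · intro k hk
      rcases List.mem_append.1 hk with hk | hk
      · exact hω.1.1 k hk
      · exact hτ.1.1 k hk
    · rw [← hω.1.2, ← hτ.1.2]
      unfold wordProd
      rw [List.map_append, List.prod_append]
    · rw [List.length_append, hω.2, hτ.2, h]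
  rw [star_eq hω, ← foldr_simpleStar_one hτ, ← List.foldr_append, foldr_simpleStar_one h1,
    foldr_simpleStar_one hτ]

/-- The four forms of the factor `Q_i`, for `1 ≤ i ≤ n - 1`. -/
inductive FactorForm (n i : ℕ) : Type
  /-- `id` -/
  | form0 : FactorForm n i
  /-- `s_i ⋯ s_j`, where `i ≤ j ≤ n - 1` -/
  | form1 (j : ℕ) (hij : i ≤ j) (hj : j ≤ n - 1) : FactorForm n i
  /-- `s_i ⋯ s_{n-2} s_n s_{n-1} ⋯ s_j`, where `i ≤ j ≤ n - 1` (this is `s_n s_{n-1}`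
  for `i = n - 1`) -/
  | form2 (j : ℕ) (hij : i ≤ j) (hj : j ≤ n - 1) : FactorForm n i
  /-- `s_i ⋯ s_{n-2} s_n` (this is `s_n` for `i = n - 1`) -/
  | form3 : FactorForm n i

namespace FactorForm

variable {i : ℕ}

/-- The list `a, a + 1, …, b` (empty for `b < a`). -/
def up (a b : ℕ) : List ℕ := List.Ico a (b + 1)

/-- The word in the indices of the generators which defines `Q_i`. -/
def word : FactorForm n i → List ℕ
  | form0 => []
  | form1 j _ _ => up i j
  | form2 j _ _ => up i (n - 2) ++ [n] ++ (up j (n - 1)).reverse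
  | form3 => up i (n - 2) ++ [n]

/-- The factor `Q_i`. -/
def Q (F : FactorForm n i) : DGroup n := wordProd n F.word

/-- The integers in the list `L_i`:
`[]` for form 0, `[i+1, …, j+1]` for form 1, `[i+1, …, n, -n, …, -(j+1)]` for form 2 (this is
`[n, -n]` for `i = n - 1`), `[i+1, …, n-1, -n]` for form 3 (this is `[-n]` for `i = n - 1`). -/
def ints : FactorForm n i → List ℤ
  | form0 => []
  | form1 j _ _ => (up (i + 1) (j + 1)).map fun k => (k : ℤ)
  | form2 j _ _ => ((up (i + 1) n).map fun k => (k : ℤ)) ++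
      (up (j + 1) n).reverse.map fun k => -(k : ℤ)
  | form3 => ((up (i + 1) (n - 1)).map fun k => (k : ℤ)) ++ [-(n : ℤ)]

/-- The list `L_i`. -/
def L (F : FactorForm n i) : List (Letter n) := Letter.ofInts n F.ints

end FactorForm

end HopD

namespace HopD

open SignedPerm

variable {n : ℕ}

/-! The factor `Q` is built one generator at a time on the right, and each new generator adds one
letter at the end of the hopping list. Suppose that `star Q w` is hopping of `t` over `L` applied to
`Q w`, for every `w`, and that `s_k` exchanges the simple pair `c < d` with `Q c = t` and `Q d = q >
t`. Then `Q s_k w` is `Q w` with `t` and `q` exchanged, and the positions of `t` and `q` in `Q w`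
are those of `c` and `d` in `w`. So whether `s_k` is a left descent of `w` can be read off from the
order of `t` and `q`.

If `s_k` is a descent, then `s_k ⋆ w = w`. In `Q s_k w` the letter `q` stands to the right of `t`,
and as the last entry of the list it is hopped over first; this undoes `s_k` and gives `Q w`. If
`s_k` is not a descent, then `s_k ⋆ w = s_k w`, and `q` already stands to the left of `t` in `Q s_k
w`. In both cases `q` is now to the left of `t`. Since `t` only moves right, `q` plays no further
part (`hop_append_of_gt`), and what remains is hopping over `L`, that is, `Q ⋆ (s_k ⋆ w)`. This is
`HopsTo.mul_s`.

It remains to run through the words of the three nontrivial forms, following which letter the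
partial product sends to `i` and where it sends the partner of that letter: the partner's image is
the next entry of `L_i`. -/

/-- A generator exchanges two simple pairs, `(a, b)` and `(-b, -a)`. The second is the relevant one
once the letter sent to `i` has become negative, and already for `s_n` in form 2. -/
theorem IsSimple.neg {a b : Letter n} (h : IsSimple a b) : IsSimple (-b) (-a) := by
  refine ⟨Letter.neg_lt_neg h.1, fun e => h.2.1 (by rw [← neg_neg b, ← e]), fun x y hxy hne => ?_⟩
  rw [signedSwap_neg, neg_neg, neg_neg]
  rcases h.2.2 x y hxy hne with h1 | h1 | h1
  · exact Or.inl h1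
  · exact Or.inr (Or.inr h1)
  · exact Or.inr (Or.inl h1)

/-! ### Hopping over a list extended by one letter -/

namespace SignedPerm

theorem signedSwap_mul_inv_apply (a b : Letter n) (w : SignedPerm n) (x : Letter n) :
    (signedSwap a b * w).1⁻¹ x = w.1⁻¹ ((signedSwap a b).1 x) := by
  change ((signedSwap a b * w)⁻¹).1 x = _
  rw [mul_inv_rev, inv_eq_of_mul_eq_one_right (signedSwap_mul_self a b)]
  rfl

theorem hop_eq_self {t : Letter n} {L : List (Letter n)} {w : SignedPerm n}
    (h : ∀ q ∈ L, w.1⁻¹ q < w.1⁻¹ t) : hop t L w = w := by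
  have h0 : (L.filter fun q => w.1⁻¹ t < w.1⁻¹ q ∧ t < q) = [] := by
    rw [List.filter_eq_nil_iff]
    intro q hq
    simpa using fun h1 => absurd (h q hq) (not_lt_of_gt h1)
  rw [hop]
  split
  · rfl
  · next h1 => rw [h0] at h1; simp at h1

/-- The last entry of the list has priority over all others, so the first hop is over `q`. -/
theorem hop_append_of_lt {t q : Letter n} (L : List (Letter n)) {w : SignedPerm n} (htq : t < q)
    (h : w.1⁻¹ t < w.1⁻¹ q) : hop t (L ++ [q]) w = hop t (L ++ [q]) (signedSwap t q * w) := by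
  have h0 : ((L ++ [q]).filter fun q => w.1⁻¹ t < w.1⁻¹ q ∧ t < q).getLast? = some q := by
    rw [List.filter_append, List.filter_cons_of_pos (by simpa using ⟨h, htq⟩), List.filter_nil,
      List.getLast?_concat]
  rw [hop]
  split
  · next h1 => rw [h0] at h1; simp at h1
  · next h1 => rw [h0] at h1; cases h1; rfl

/-- Hopping over a letter of `L` keeps a letter `q` to the left of `t` if it is there at first,
so that `q` has no effect at the end of the list. -/
theorem hop_append_of_gt {t q : Letter n} {L : List (Letter n)} {w : SignedPerm n}
    (hqt : q ≠ -t) (hL : ∀ x ∈ L, x ≠ -t) (h : w.1⁻¹ q < w.1⁻¹ t) :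
    hop t (L ++ [q]) w = hop t L w := by
  induction w using hop.induct t L with
  | case1 w h1 =>
    have h0 : ((L ++ [q]).filter fun q => w.1⁻¹ t < w.1⁻¹ q ∧ t < q).getLast? = none := by
      rwa [List.filter_append, List.filter_cons_of_neg (by simpa using fun h1 => absurd h h1.not_gt),
        List.filter_nil, List.append_nil]
    rw [hop, hop]
    split
    · split
      · rfl
      · next h2 => rw [h1] at h2; simp at h2
    · next h2 => rw [h0] at h2; simp at h2
  | case2 w x h1 ih =>
    -- `q` is not a candidate, so both lists select the same letter `x`.
    have h0 : ((L ++ [q]).filter fun q => w.1⁻¹ t < w.1⁻¹ q ∧ t < q).getLast? = some x := by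
      rwa [List.filter_append, List.filter_cons_of_neg (by simpa using fun h1 => absurd h h1.not_gt),
        List.filter_nil, List.append_nil]
    have hx := List.mem_of_getLast? h1
    simp only [List.mem_filter, decide_eq_true_eq] at hx
    have h3 : hop t (L ++ [q]) w = hop t (L ++ [q]) (signedSwap t x * w) := by
      rw [hop]
      split
      · next h2 => rw [h0] at h2; simp at h2
      · next h2 => rw [h0] at h2; cases h2; rfl
    have h4 : hop t L w = hop t L (signedSwap t x * w) := by
      rw [hop]
      split
      · next h2 => rw [h1] at h2; simp at h2
      · next h2 => rw [h1] at h2; cases h2; rfl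
    rw [h3, h4]
    apply ih
    rw [signedSwap_mul_inv_apply, signedSwap_mul_inv_apply, signedSwap_left]
    have h5 : q ≠ t := by rintro rfl; exact lt_irrefl _ h
    have h6 : q ≠ x := by rintro rfl; exact lt_asymm h hx.2.1
    -- The hop puts `t` where `x` was, further to the right. It moves `q` only if `q = -x`, to the
    -- former place of `-t`; negating the positions in "`-x` is left of `t`" gives "`-t` is left of
    -- `x`", as required.
    by_cases h7 : q = -x
    · have h8 : (signedSwap t x).1 q = -t := by rw [h7, apply_neg, signedSwap_right]
      rw [h8, inv_apply_neg]
      rw [h7, inv_apply_neg] at h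
      simpa only [neg_neg] using Letter.neg_lt_neg h
    · rw [signedSwap_apply, if_neg h5, if_neg h6, if_neg hqt, if_neg h7]
      exact h.trans hx.2.1

end SignedPerm

/-! ### The inductive step: one more generator -/

/-- Demazure multiplication by `Q` on the left is ordinary multiplication followed by hopping
of `t` over `L`. -/
structure HopsTo (Q : DGroup n) (t : Letter n) (L : List (Letter n)) : Prop where
  star_eq : ∀ w : DGroup n, (star Q w : SignedPerm n) = hop t L (Q * w : DGroup n)
  ne_neg : ∀ q ∈ L, q ≠ -t
  inv_lt : ∀ q ∈ L, Q.1.1⁻¹ q < Q.1.1⁻¹ t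

theorem HopsTo.one (t : Letter n) : HopsTo 1 t [] :=
  ⟨fun w => by rw [one_star, one_mul, hop_eq_self (by simp)], by simp, by simp⟩

/-- Associativity of the Demazure product reduces the claim for `Q s_k` to the one for `Q`, applied
to `s_k ⋆ w`. The field `inv_lt` of `HopsTo` makes the product `Q s_k` a Demazure product, and
`ne_neg` serves to carry `inv_lt` through the induction. -/
theorem HopsTo.mul_s {Q : DGroup n} {t q c d : Letter n} {L : List (Letter n)} {k : ℕ}
    (h : HopsTo Q t L) (hn : 2 ≤ n) (hk : 1 ≤ k ∧ k ≤ n) (hcd : IsSimple c d)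
    (e : (s n k).1 = signedSwap c d) (hc : Q.1.1 c = t) (hd : Q.1.1 d = q) (htq : t < q) :
    HopsTo (Q * s n k) t (L ++ [q]) := by
  have hct : Q.1.1⁻¹ t = c := by rw [← hc]; exact Equiv.symm_apply_apply _ _
  have hdq : Q.1.1⁻¹ q = d := by rw [← hd]; exact Equiv.symm_apply_apply _ _
  have hqt : q ≠ -t := by
    rw [← hc, ← hd, ← apply_neg]
    exact fun e => hcd.2.1 (Q.1.1.injective e)
  have hinv : ∀ x, (Q * s n k : DGroup n).1.1⁻¹ x = (signedSwap c d).1 (Q.1.1⁻¹ x) := by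
    intro x
    change ((Q.1 * (s n k).1)⁻¹).1 x = _
    rw [e, mul_inv_rev, inv_eq_of_mul_eq_one_right (signedSwap_mul_self c d)]
    rfl
  -- In `Q s_k` the letter `t` stands at `d`. A letter of `L` stood to the left of `c` in `Q`, not
  -- opposite to it, and a simple exchange keeps that order; `q` itself moves to `c < d`.
  have hlt : ∀ x ∈ L ++ [q], (Q * s n k : DGroup n).1.1⁻¹ x < (Q * s n k : DGroup n).1.1⁻¹ t := by
    intro x hx
    rw [hinv, hinv, hct, signedSwap_left]
    rcases List.mem_append.1 hx with hx | hx
    · have h1 := h.inv_lt x hx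
      rw [hct] at h1
      have h2 : c ≠ -Q.1.1⁻¹ x := by
        rw [← hct]
        intro e
        rw [← inv_apply_neg] at e
        exact h.ne_neg x hx (by rw [(Q.1.1⁻¹).injective e, neg_neg])
      rcases hcd.2.2 _ _ h1 h2 with h3 | h3 | h3
      · rwa [signedSwap_left] at h3
      · exact absurd h3.2 hcd.1.ne
      · have h4 := congrArg Letter.val h3.2
        have h5 := c.ne_zero
        rw [Letter.val_neg] at h4
        omega
    · rw [List.mem_singleton.1 hx, hdq, signedSwap_right]
      exact hcd.1
  -- No separate length count is needed: by the hypothesis on `Q` at `w = s_k`, the Demazure product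
  -- is a hopping of `Q s_k`, where nothing of `L` is to the right of `t`.
  have hstar : star Q (s n k) = Q * s n k := by
    apply Subtype.ext
    rw [h.star_eq, hop_eq_self]
    exact fun x hx => hlt x (List.mem_append_left _ hx)
  refine ⟨fun w => ?_, ?_, hlt⟩
  · have hv : (Q * s n k * w : DGroup n).1 = signedSwap t q * (Q * w : DGroup n).1 := by
      change Q.1 * (s n k).1 * w.1 = signedSwap t q * (Q.1 * w.1)
      rw [e, ← conj_signedSwap, hc, hd, mul_assoc]
    have hp : ∀ x, (Q * w : DGroup n).1.1⁻¹ x = w.1.1⁻¹ (Q.1.1⁻¹ x) := by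
      intro x
      change ((Q.1 * w.1)⁻¹).1 x = _
      rw [mul_inv_rev]
      rfl
    rw [← hstar, star_assoc, hstar, s_star hn hk, simpleStar]
    have hiff := length_s_mul_lt hcd e w
    by_cases hw : (w.1⁻¹).1 d < (w.1⁻¹).1 c
    -- Descent: the hop over `q` cancels the exchange and leaves `Q w`, with `q` to the left of `t`.
    · rw [if_pos (hiff.2 hw), h.star_eq, hop_append_of_lt L htq, hv, ← mul_assoc, signedSwap_mul_self,
        one_mul, hop_append_of_gt hqt h.ne_neg]
      · rw [hp, hp, hct, hdq]
        exact hw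
      · rw [hv, signedSwap_mul_inv_apply, signedSwap_mul_inv_apply, signedSwap_left,
          signedSwap_right, hp, hp, hct, hdq]
        exact hw
    -- No descent: `q` is already to the left of `t` in `Q s_k w`, and can be dropped from the list.
    · rw [if_neg (mt hiff.1 hw), h.star_eq, ← mul_assoc, hop_append_of_gt hqt h.ne_neg]
      rw [hv, signedSwap_mul_inv_apply, signedSwap_mul_inv_apply, signedSwap_left,
          signedSwap_right, hp, hp, hct, hdq]
      exact lt_of_le_of_ne (not_lt.1 hw) fun e => hcd.1.ne ((w.1⁻¹).1.injective e)
  · intro x hx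
    rcases List.mem_append.1 hx with hx | hx
    · exact h.ne_neg x hx
    · rwa [List.mem_singleton.1 hx]

/-! ### Words and the action of the generators -/

theorem wordProd_append (ω τ : List ℕ) : wordProd n (ω ++ τ) = wordProd n ω * wordProd n τ := by
  unfold wordProd
  rw [List.map_append, List.prod_append]

theorem wordProd_singleton (k : ℕ) : wordProd n [k] = s n k := by
  unfold wordProd
  rw [List.map_singleton, List.prod_singleton]

/-- Conjugation by `s_n` sends the pair `(n-1, n)` to `(-n, -(n-1))`, which defines the same signed
exchange. -/
theorem s_last_comm (hn : 2 ≤ n) : s n n * s n (n - 1) = s n (n - 1) * s n n := by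
  apply Subtype.ext
  change (s n n).1 * (s n (n - 1)).1 = (s n (n - 1)).1 * (s n n).1
  have e : (Letter.pos (n - 1 + 1) ⟨by omega, by omega⟩ : Letter n) = Letter.pos n (by omega) := by
    simp only [Letter.ext_iff, Letter.pos]; omega
  rw [s_last hn, s_eq (by omega) (by omega), e, ← conj_signedSwap, signedSwap_left]
  have h := signedSwap_right (Letter.pos (n - 1) (by omega) : Letter n) (-Letter.pos n (by omega))
  rw [apply_neg, neg_eq_iff_eq_neg] at h
  rw [h, signedSwap_neg]

namespace Letter

theorem ofInts_append (l m : List ℤ) : ofInts n (l ++ m) = ofInts n l ++ ofInts n m :=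
  List.filterMap_append

theorem ofInts_singleton (x : Letter n) : ofInts n [x.val] = [x] := by
  simp [ofInts, x.range]

end Letter

theorem s_apply_pos {k : ℕ} (h1 : 1 ≤ k) (h2 : k < n) (x : Letter n) :
    ((s n k).1.1 x).val = if x.val = k then (k : ℤ) + 1 else if x.val = k + 1 then (k : ℤ) else
      if x.val = -k then -((k : ℤ) + 1) else if x.val = -(k + 1) then -(k : ℤ) else x.val := by
  rw [s_eq h1 h2, signedSwap_apply]
  simp only [Letter.ext_iff, Letter.val_neg, Letter.pos]
  split_ifs <;> simp_all

theorem s_last_apply (hn : 2 ≤ n) (x : Letter n) (hx : x.val < n - 1) (hx' : 0 < x.val) :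
    (s n n).1.1 x = x := by
  rw [s_last hn, signedSwap_apply]
  simp only [Letter.ext_iff, Letter.val_neg, Letter.pos]
  split_ifs <;> simp_all <;> omega

/-! ### The partial products of the factors -/

/-- The product `s_i ⋯ s_{m-1}` sends `m` to `i`, and `k` to `k + 1` for `i ≤ k < m`. -/
theorem hopsTo_ascending {i m : ℕ} (hi : 1 ≤ i) (him : i ≤ m) (hm : m ≤ n) :
    HopsTo (wordProd n (List.Ico i m)) (Letter.pos i ⟨hi, him.trans hm⟩)
      (Letter.ofInts n ((List.Ico (i + 1) (m + 1)).map fun k : ℕ => (k : ℤ))) ∧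
    ∀ x : Letter n, (x.val = m → ((wordProd n (List.Ico i m)).1.1 x).val = i) ∧
      (m < x.val → ((wordProd n (List.Ico i m)).1.1 x).val = x.val) ∧
      (i ≤ x.val → x.val < m → ((wordProd n (List.Ico i m)).1.1 x).val = x.val + 1) := by
  induction m, him using Nat.le_induction with
  | base =>
    rw [List.Ico.self_empty, List.Ico.self_empty]
    exact ⟨HopsTo.one _, fun x => ⟨fun h => h, fun _ => rfl, fun _ _ => by omega⟩⟩
  | succ m him ih =>
    obtain ⟨h1, h2⟩ := ih (by omega)
    have hlt : m < n := by omega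
    rw [List.Ico.succ_top him, List.Ico.succ_top (show i + 1 ≤ m + 1 by omega), wordProd_append,
      wordProd_singleton, List.map_append, Letter.ofInts_append]
    refine ⟨?_, fun x => ?_⟩
    · have := Letter.ofInts_singleton (Letter.pos (m + 1) ⟨by omega, hm⟩ : Letter n)
      simp only [Letter.pos] at this
      rw [List.map_singleton, this]
      -- The simple pair is `(m, m+1)`: the product so far sends `m` to `i` and fixes `m+1`, so the
      -- new entry is `m+1`.
      refine h1.mul_s (by omega) ⟨by omega, by omega⟩ (isSimple_pos (by omega) hlt)
        (s_eq (by omega) hlt) (Letter.ext ?_) (Letter.ext ?_) ?_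
      · exact (h2 _).1 rfl
      · exact (h2 _).2.1 (by simp only [Letter.pos]; omega)
      · simp only [Letter.lt_iff, Letter.rank, Letter.pos]
        split_ifs <;> omega
    · have h3 := s_apply_pos (by omega) hlt x
      change (_ → ((wordProd n (List.Ico i m)).1.1 ((s n m).1.1 x)).val = _) ∧
        (_ → ((wordProd n (List.Ico i m)).1.1 ((s n m).1.1 x)).val = _) ∧
        (_ → _ → ((wordProd n (List.Ico i m)).1.1 ((s n m).1.1 x)).val = _)
      have h4 := h2 ((s n m).1.1 x)
      push_cast
      split_ifs at h3 <;> omega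

/-- The product `s_i ⋯ s_{n-1} s_n s_{n-2} ⋯ s_j` sends `-j` to `i`, and `k` to `k + 1` for
`i ≤ k < j`. -/
theorem hopsTo_descending {i j : ℕ} (hi : 1 ≤ i) (hij : i ≤ j) (hj : j ≤ n - 1) :
    HopsTo (wordProd n (List.Ico i n ++ [n] ++ (List.Ico j (n - 1)).reverse))
      (Letter.pos i ⟨hi, by omega⟩)
      (Letter.ofInts n (((List.Ico (i + 1) (n + 1)).map fun k : ℕ => (k : ℤ)) ++
        (List.Ico (j + 1) (n + 1)).reverse.map fun k : ℕ => -(k : ℤ))) ∧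
    ∀ x : Letter n,
      (x.val = -j → ((wordProd n (List.Ico i n ++ [n] ++ (List.Ico j (n - 1)).reverse)).1.1 x).val
        = i) ∧
      (i ≤ x.val → x.val < j →
        ((wordProd n (List.Ico i n ++ [n] ++ (List.Ico j (n - 1)).reverse)).1.1 x).val =
          x.val + 1) := by
  -- Induction on `n - 1 - j`: the word grows on the right as `j` decreases.
  obtain ⟨d, hd⟩ : ∃ d, j + d = n - 1 := ⟨n - 1 - j, by omega⟩
  induction d generalizing j with
  | zero =>
    obtain rfl : j = n - 1 := hd
    have hn : 2 ≤ n := by omega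
    obtain ⟨h1, h2⟩ := hopsTo_ascending (m := n) hi (by omega) le_rfl
    rw [List.Ico.self_empty, List.reverse_nil, List.append_nil, wordProd_append,
      wordProd_singleton, Nat.sub_add_cancel (by omega), List.Ico.succ_singleton,
      List.reverse_singleton, List.map_singleton, Letter.ofInts_append]
    have hlast : (s n n).1.1 (-Letter.pos (n - 1) (by omega)) = Letter.pos n (by omega) := by
      rw [apply_neg, s_last hn, signedSwap_left, neg_neg]
    refine ⟨?_, fun x => ⟨fun hx => ?_, fun hx hx' => ?_⟩⟩
    · have := Letter.ofInts_singleton (-Letter.pos n ⟨by omega, le_rfl⟩ : Letter n)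
      simp only [Letter.pos, Letter.val_neg] at this
      rw [this]
      -- Here `s_n` acts through its pair `(n, -(n-1))`: the ascending product sends `n` to `i` and
      -- `n-1` to `n`, so the new entry is `-n`.
      have hs := (isSimple_last hn).neg
      rw [neg_neg] at hs
      refine h1.mul_s hn ⟨by omega, le_rfl⟩ hs ?_ (Letter.ext ?_) ?_ ?_
      · rw [s_last hn, ← signedSwap_neg, neg_neg]
      · exact (h2 _).1 rfl
      · rw [apply_neg]
        congr 1
        refine Letter.ext (((h2 _).2.2 ?_ ?_).trans ?_) <;> simp only [Letter.pos] <;> omega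
      · simp only [Letter.lt_iff, Letter.rank, Letter.pos, Letter.val_neg]
        split_ifs <;> omega
    · have hxe : x = -Letter.pos (n - 1) (by omega) := Letter.ext hx
      change ((wordProd n (List.Ico i n)).1.1 ((s n n).1.1 x)).val = i
      rw [hxe, hlast]
      exact (h2 _).1 rfl
    · change ((wordProd n (List.Ico i n)).1.1 ((s n n).1.1 x)).val = x.val + 1
      rw [s_last_apply hn x (by omega) (by omega)]
      exact (h2 _).2.2 hx (by omega)
  | succ d ih =>
    obtain ⟨h1, h2⟩ := ih (j := j + 1) (by omega) (by omega) (by omega)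
    have hlt : j < n := by omega
    rw [List.Ico.eq_cons (show j < n - 1 by omega), List.Ico.eq_cons (show j + 1 < n + 1 by omega),
      List.reverse_cons, List.reverse_cons, List.map_append, ← List.append_assoc,
      ← List.append_assoc, wordProd_append _ [j], wordProd_singleton,
      Letter.ofInts_append _ (List.map _ [j + 1])]
    refine ⟨?_, fun x => ?_⟩
    · have := Letter.ofInts_singleton (-Letter.pos (j + 1) ⟨by omega, hlt⟩ : Letter n)
      simp only [Letter.pos, Letter.val_neg] at this
      rw [List.map_singleton, this]
      -- The simple pair is `(-(j+1), -j)`: the product so far sends `-(j+1)` to `i` and `j` to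
      -- `j+1`, so the new entry is `-(j+1)`.
      refine h1.mul_s (by omega) ⟨by omega, by omega⟩ (isSimple_pos (by omega) hlt).neg
        ?_ (Letter.ext ?_) ?_ ?_
      · rw [signedSwap_neg, s_eq (by omega) hlt]
      · exact (h2 _).1 rfl
      · rw [apply_neg]
        congr 1
        refine Letter.ext (((h2 _).2 ?_ ?_).trans ?_) <;> simp only [Letter.pos] <;> omega
      · simp only [Letter.lt_iff, Letter.rank, Letter.pos, Letter.val_neg]
        split_ifs <;> omega
    · have h3 := s_apply_pos (by omega) hlt x
      have h4 := h2 ((s n j).1.1 x)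
      generalize wordProd n (List.Ico i n ++ [n] ++ (List.Ico (j + 1) (n - 1)).reverse) = Q at *
      change (_ → (Q.1.1 ((s n j).1.1 x)).val = _) ∧ (_ → _ → (Q.1.1 ((s n j).1.1 x)).val = _)
      push_cast at h4
      split_ifs at h3 <;> omega

/-- Without `s_{n-1}`, the ascending product sends `n-1` to `i` and fixes `n`. So `s_n` acts through
its pair `(n-1, -n)` and contributes `-n`, and the list skips `n`. -/
theorem hopsTo_form3 {i : ℕ} (hi : 1 ≤ i) (hin : i ≤ n - 1) :
    HopsTo (wordProd n (List.Ico i (n - 1) ++ [n])) (Letter.pos i ⟨hi, by omega⟩)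
      (Letter.ofInts n (((List.Ico (i + 1) n).map fun k : ℕ => (k : ℤ)) ++ [-(n : ℤ)])) := by
  have hn : 2 ≤ n := by omega
  obtain ⟨h1, h2⟩ := hopsTo_ascending (n := n) hi hin (by omega)
  rw [Nat.sub_add_cancel (by omega)] at h1
  have := Letter.ofInts_singleton (-Letter.pos n ⟨by omega, le_rfl⟩ : Letter n)
  simp only [Letter.pos, Letter.val_neg] at this
  rw [wordProd_append, wordProd_singleton, Letter.ofInts_append, this]
  refine h1.mul_s hn ⟨by omega, le_rfl⟩ (isSimple_last hn) (s_last hn) (Letter.ext ?_) ?_ ?_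
  · exact (h2 _).1 rfl
  · rw [apply_neg]
    congr 1
    refine Letter.ext ((h2 _).2.1 ?_)
    simp only [Letter.pos]; omega
  · simp only [Letter.lt_iff, Letter.rank, Letter.pos, Letter.val_neg]
    split_ifs <;> omega

/-! ### The four forms -/

/-- The form in which the casts in `FactorForm.ints` are elaborated. -/
theorem bind_pure_natCast (l : List ℕ) :
    (do let a ← l; pure (a : ℤ)) = l.map fun k : ℕ => (k : ℤ) := by
  induction l with
  | nil => rfl
  | cons a l ih => simpa using ih

theorem FactorForm.hopsTo {i : ℕ} (hi : 1 ≤ i) (hin : i ≤ n - 1) (F : FactorForm n i) :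
    HopsTo F.Q (Letter.pos i ⟨hi, hin.trans (Nat.sub_le n 1)⟩) F.L := by
  have hn : 2 ≤ n := by omega
  cases F with
  | form0 => exact HopsTo.one _
  | form1 j hij hj =>
    rw [Q, L, word, ints, up, up, bind_pure_natCast, List.map_map]
    exact (hopsTo_ascending hi (show i ≤ j + 1 by omega) (by omega)).1
  | form2 j hij hj =>
    have e1 : List.Ico i n = List.Ico i (n - 1) ++ [n - 1] := by
      rw [← List.Ico.succ_top hin, Nat.sub_add_cancel (by omega)]
    have e2 : List.Ico j n = List.Ico j (n - 1) ++ [n - 1] := by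
      rw [← List.Ico.succ_top hj, Nat.sub_add_cancel (by omega)]
    -- The commuting generators `s_n` and `s_{n-1}` are interchanged, so that the word produces the
    -- entry `n` before `-n`, as in `L_i`.
    have e : (form2 j hij hj : FactorForm n i).Q =
        wordProd n (List.Ico i n ++ [n] ++ (List.Ico j (n - 1)).reverse) := by
      rw [Q, word, up, up, Nat.sub_add_cancel (by omega), e2, show n - 2 + 1 = n - 1 by omega, e1,
        List.reverse_append, List.reverse_singleton]
      simp only [wordProd_append, wordProd_singleton, mul_assoc]
      rw [← mul_assoc (s n n), s_last_comm hn, mul_assoc]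
    rw [e, L, ints, up, up, bind_pure_natCast, bind_pure_natCast, List.map_map, List.map_map]
    exact (hopsTo_descending hi hij hj).1
  | form3 =>
    rw [Q, L, word, ints, up, up, show n - 2 + 1 = n - 1 by omega, Nat.sub_add_cancel (by omega),
      bind_pure_natCast, List.map_map]
    exact hopsTo_form3 hi hin

end HopD

theorem mainTheorem2 (n i : ℕ) (hi : 1 ≤ i ∧ i ≤ n - 1) (F : HopD.FactorForm n i)
    (w : HopD.DGroup n) :
    (HopD.star F.Q w : HopD.SignedPerm n) =
      HopD.SignedPerm.hop (HopD.Letter.pos i ⟨hi.1, hi.2.trans (Nat.sub_le n 1)⟩) F.L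
        (F.Q * w : HopD.DGroup n) :=
  (F.hopsTo hi.1 hi.2).star_eq w
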